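/- Equip $\mathbb R^{2n+1}$, with coordinates $(x_1,\dots,x_n,y_1,\dots,y_n,z)$, with the contact form $\eta=\frac12dz-\frac14\sum_i(y_i\,dx_i-x_i\,dy_i)$, the Reeb field $\xi=2\,\partial_z$ and the Riemannian metric $g=\frac14\sum_i(dx_i^2+dy_i^2)+\eta\otimes\eta$. For a smooth function $u:\mathbb R^n\to\mathbb R$ put $V=u-\frac12x\cdot Du$, and let $$\Sigma=\{X=(x,Du(x),V(x)) : x\in\mathbb R^n\}\subset\mathbb R^{2n+1}$$ be the corresponding entire Legendrian graph, with the metric induced by $g$, its volume measure $d\mu$, and its mean curvature vector $H$ (the trace of the second fundamental form with respect to the Levi-Civita connection of $g$). Assume that $\Sigma$ is a Legendrian self-shrinker, that is, $$H-\theta\,\xi=-\tfrac12X^{\perp}\quad\text{on }\Sigma$$ for some function $\theta:\Sigma\to\mathbb R$ (the Legendrian angle), where the position vector $X=\sum_i(x_i\,\partial_{x_i}+u_i\,\partial_{y_i})+V\,\partial_z$ is regarded as a tangent vector of $\mathbb R^{2n+1}$ at the point $X$, and $X^\perp$ is its component normal to $\Sigma$. Put $$f=\tfrac14\left(|X|^2-\tfrac14V^2\right),\quad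 |X|^2=g_X(X,X),\qquad D_r=\{p\in\Sigma : 2\sqrt{f(p)}\le r\}.$$ Then the weighted volume of $\Sigma$ is finite, $$\int_\Sigma e^{-f}\,d\mu<\infty,$$ and $$\mathrm{Vol}(D_r)=\int_{D_r}d\mu\le C_1r^n\qquad\text{for all } r\ge1,$$ where $C_1>0$ depends only on the value of $\int_\Sigma e^{-f}\,d\mu$. -/

import Mathlib

open scoped ContDiff Matrix

namespace ContactGraph

/-- Index set of the coordinates `(x₁,…,xₙ, y₁,…,yₙ, z)` of the contact space. -/
abbrev Coord (n : ℕ) : Type := Fin n ⊕ Fin n ⊕ Unit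

/-- The coordinate space `ℝ²ⁿ⁺¹`; it also serves as the tangent space at each of its points,
with components taken in the coordinate frame `∂/∂xᵢ, ∂/∂yᵢ, ∂/∂z`. -/
abbrev Space (n : ℕ) : Type := Coord n → ℝ

/-- The `xᵢ`-component of a point or of a vector. -/
def xc {n : ℕ} (p : Space n) (i : Fin n) : ℝ := p (Sum.inl i)

/-- The `yᵢ`-component of a point or of a vector. -/
def yc {n : ℕ} (p : Space n) (i : Fin n) : ℝ := p (Sum.inr (Sum.inl i))

/-- The `z`-component of a point or of a vector. -/
def zc {n : ℕ} (p : Space n) : ℝ := p (Sum.inr (Sum.inr ()))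

/-- The contact form `η = ½ dz − ¼ ∑ (yᵢ dxᵢ − xᵢ dyᵢ)` at `p`, applied to `v`. -/
noncomputable def contactForm {n : ℕ} (p v : Space n) : ℝ :=
  (1 / 2) * zc v - (1 / 4) * ∑ i, (yc p i * xc v i - xc p i * yc v i)

/-- The Reeb vector field `ξ = 2 ∂/∂z`. -/
def reeb (n : ℕ) : Space n := Pi.single (Sum.inr (Sum.inr ())) 2

/-- The Riemannian metric `g = ¼ ∑ (dxᵢ² + dyᵢ²) + η ⊗ η` at `p`. -/
noncomputable def metric {n : ℕ} (p v w : Space n) : ℝ :=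
  (1 / 4) * ∑ i, (xc v i * xc w i + yc v i * yc w i) + contactForm p v * contactForm p w

/-- The coordinate vector field `∂/∂pᵃ`. -/
def coordVec {n : ℕ} (a : Coord n) : Space n := Pi.single a 1

/-- The Gram matrix of `g` in coordinates. -/
noncomputable def metricMatrix {n : ℕ} (p : Space n) : Matrix (Coord n) (Coord n) ℝ :=
  Matrix.of fun a b => metric p (coordVec a) (coordVec b)

/-- The Christoffel symbols of the Levi-Civita connection of `g`, as a bilinear expression:
`Γ(v,w)ᵈ = ½ gᵈᶜ (v(g(w,∂_c)) + w(g(v,∂_c)) − ∂_c(g(v,w)))` for constant `v`, `w`. -/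
noncomputable def christoffel {n : ℕ} (p v w : Space n) : Space n :=
  (metricMatrix p)⁻¹ *ᵥ fun c =>
    (1 / 2) * (fderiv ℝ (fun q => metric q w (coordVec c)) p v
      + fderiv ℝ (fun q => metric q v (coordVec c)) p w
      - fderiv ℝ (fun q => metric q v w) p (coordVec c))

/-- The partial derivative `∂F/∂xᵢ` of a map on `ℝⁿ`. -/
noncomputable def pd {n : ℕ} {E : Type*} [NormedAddCommGroup E] [NormedSpace ℝ E]
    (i : Fin n) (F : (Fin n → ℝ) → E) (x : Fin n → ℝ) : E :=
  fderiv ℝ F x (Pi.single i 1)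

/-- The function `V = u − ½ x · Du`. -/
noncomputable def height {n : ℕ} (u : (Fin n → ℝ) → ℝ) (x : Fin n → ℝ) : ℝ :=
  u x - (1 / 2) * ∑ i, x i * pd i u x

/-- The parametrization `X(x) = (x, Du(x), u(x) − ½ x · Du(x))` of the Legendrian graph `Σ`. -/
noncomputable def position {n : ℕ} (u : (Fin n → ℝ) → ℝ) (x : Fin n → ℝ) : Space n :=
  Sum.elim x (Sum.elim (fun i => pd i u x) (fun _ => height u x))

/-- The coordinate tangent vector `eᵢ = ∂X/∂xᵢ` of `Σ`. -/
noncomputable def tangentVec {n : ℕ} (u : (Fin n → ℝ) → ℝ) (i : Fin n) (x : Fin n → ℝ) :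
    Space n :=
  pd i (position u) x

/-- The induced metric `gᵢⱼ = ⟨eᵢ, eⱼ⟩` on `Σ`. -/
noncomputable def inducedMetric {n : ℕ} (u : (Fin n → ℝ) → ℝ) (x : Fin n → ℝ) :
    Matrix (Fin n) (Fin n) ℝ :=
  Matrix.of fun i j => metric (position u x) (tangentVec u i x) (tangentVec u j x)

/-- The component `w^⊥ = w − gⁱʲ ⟨w, eᵢ⟩ eⱼ` of `w` normal to `Σ`, at the point `X(x)`. -/
noncomputable def normalPart {n : ℕ} (u : (Fin n → ℝ) → ℝ) (x : Fin n → ℝ) (w : Space n) :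
    Space n :=
  w - ∑ i, ∑ j, ((inducedMetric u x)⁻¹ i j * metric (position u x) w (tangentVec u i x)) •
    tangentVec u j x

/-- The ambient covariant derivative of `eⱼ` in the direction `eᵢ` along `Σ`. -/
noncomputable def covDeriv {n : ℕ} (u : (Fin n → ℝ) → ℝ) (i j : Fin n) (x : Fin n → ℝ) :
    Space n :=
  pd i (tangentVec u j) x + christoffel (position u x) (tangentVec u i x) (tangentVec u j x)

/-- The mean curvature vector of `Σ`: the trace `gⁱʲ (∇_{eᵢ} eⱼ)^⊥` of the second fundamental
form. -/
noncomputable def meanCurvature {n : ℕ} (u : (Fin n → ℝ) → ℝ) (x : Fin n → ℝ) : Space n :=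
  ∑ i, ∑ j, (inducedMetric u x)⁻¹ i j • normalPart u x (covDeriv u i j x)

/-- The Legendrian self-shrinker equation `H − θ ξ = −½ X^⊥`. Nothing is required of the
function `θ` besides the equation: its `ξ`-component forces `θ = V / 4` and its remaining
components then force `H = φ ∇θ`, so every normalization of the Legendrian angle for which the
equation holds is a special case. -/
def IsSelfShrinker {n : ℕ} (u θ : (Fin n → ℝ) → ℝ) : Prop :=
  ∀ x, meanCurvature u x - θ x • reeb n = -(1 / 2 : ℝ) • normalPart u x (position u x)

/-- The function `f = ¼ (|X|² − ¼ V²)` on `Σ`; the norm of the position vector is taken in `g`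
at the point `X` itself. -/
noncomputable def potential {n : ℕ} (u : (Fin n → ℝ) → ℝ) (x : Fin n → ℝ) : ℝ :=
  (1 / 4) * (metric (position u x) (position u x) (position u x) - (1 / 4) * height u x ^ 2)

/-- The Riemannian volume measure `dμ = √(det gᵢⱼ) dx` of `Σ` in its global coordinates `x`. -/
noncomputable def volumeMeasure {n : ℕ} (u : (Fin n → ℝ) → ℝ) :
    MeasureTheory.Measure (Fin n → ℝ) :=
  MeasureTheory.volume.withDensity fun x => ENNReal.ofReal (Real.sqrt (inducedMetric u x).det)

/-- The weighted volume `∫_Σ e^{−f} dμ`. -/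
noncomputable def weightedVolume {n : ℕ} (u : (Fin n → ℝ) → ℝ) : ℝ :=
  ∫ x, Real.exp (-potential u x) ∂(volumeMeasure u)

/-- The sublevel set `D_r = {2 √f ≤ r}`, in the coordinates `x`. -/
def sublevel {n : ℕ} (u : (Fin n → ℝ) → ℝ) (r : ℝ) : Set (Fin n → ℝ) :=
  {x | 2 * Real.sqrt (potential u x) ≤ r}

end ContactGraph

/-! A self-shrinking Legendrian graph behaves like a self-shrinking Lagrangian graph in `ℝ²ⁿ`.
Tangent vectors of `Σ` are horizontal, so the `η ⊗ η` part of the metric and the Christoffel terms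
drop out. Pairing the equation with the horizontal normals removes `θ ξ` and leaves a third order
equation for `u` (`IsSelfShrinker.trace_third`). Also `η(X) = V/2`, so `f = (|x|² + |Du|²)/16`,
which is proper on `ℝⁿ`.

Let `q` be the tangential part of `(x, Du)`, so that `q = 2∇f`. The third order equation gives `Δf =
n/2 - f + |∇f|²` (`IsSelfShrinker.divergence`), and orthogonal projection gives `0 ≤ |∇f|² ≤ f`.
Integrating the divergence of `Φ(f) ∇f`, with `Φ` vanishing past some level, yields the identity `H`
of the abstract part, with `k = n/2` and `e = |∇f|²`.

The rest uses only a proper function `f` on a measure space. Taking `Φ(s) = exp(-l s) χ(s)` shows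
that `l ^ k ∫ exp(-l f) χ(f)` increases on `(0,1]`. Comparing `l = 1/2` with `l = 1` bounds the
weighted volume independently of the cutoff. Comparing `l = r⁻²` with `l = 1` bounds the volume of
`{f ≤ r²/4} = D_r`, because `exp(-l f) ≥ exp(-1/4)` there. -/

open MeasureTheory

namespace ContactGraph

/-! ### Weighted volume and volume growth for a proper function on a measure space. -/

section WeightedVolume

variable {X : Type*} [TopologicalSpace X] [MeasurableSpace X] [OpensMeasurableSpace X]
  {μ : Measure X} [IsFiniteMeasureOnCompacts μ] {f e : X → ℝ} {k : ℝ}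

/-- A continuous function of a proper function `f`, cut off in the range of `f`, is integrable. -/
theorem integrable_of_vanishing_past (hf : Continuous f) (hK : ∀ R, IsCompact {x | f x ≤ R})
    {g : X → ℝ} (hg : Continuous g) {S : ℝ} (h0 : ∀ x, S ≤ f x → g x = 0) : Integrable g μ := by
  have hm : MeasurableSet {x | f x ≤ S} := (isClosed_le hf continuous_const).measurableSet
  have h1 : IntegrableOn g {x | f x ≤ S} μ :=
    hg.continuousOn.integrableOn_compact' (hK S) hm
  refine (integrableOn_iff_integrable_of_support_subset ?_).1 h1
  intro x hx
  by_contra hc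
  exact hx (h0 x (le_of_lt (not_le.1 hc)))

/-- Differentiation under the integral sign: for `l > 0` the factor `exp(-l f)` is at most `1`, so
`f |χ(f)|` dominates uniformly in `l`. -/
theorem hasDerivAt_integral_exp_mul_cutoff (hf : Continuous f) (f0 : ∀ x, 0 ≤ f x)
    (hK : ∀ R, IsCompact {x | f x ≤ R}) {χ : ℝ → ℝ} (hχ : ContDiff ℝ 1 χ) {S : ℝ}
    (hS : ∀ s, S ≤ s → χ s = 0) {l : ℝ} (hl : 0 < l) :
    HasDerivAt (fun l => ∫ x, Real.exp (-l * f x) * χ (f x) ∂μ)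
      (∫ x, -f x * (Real.exp (-l * f x) * χ (f x)) ∂μ) l := by
  have hc := hχ.continuous
  have hi : ∀ l : ℝ, Integrable (fun x => Real.exp (-l * f x) * χ (f x)) μ := fun l =>
    integrable_of_vanishing_past hf hK (by fun_prop) (S := S) fun x hx => by simp [hS _ hx]
  refine (hasDerivAt_integral_of_dominated_loc_of_deriv_le (s := Set.Ioi 0)
    (F' := fun l x => -f x * (Real.exp (-l * f x) * χ (f x)))
    (bound := fun x => f x * |χ (f x)|) (Ioi_mem_nhds hl)
    (Filter.Eventually.of_forall fun l => (hi l).aestronglyMeasurable) (hi l)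
    (integrable_of_vanishing_past hf hK (by fun_prop) (S := S)
      fun x hx => by simp [hS _ hx]).aestronglyMeasurable ?_ ?_ ?_).2
  · refine Filter.Eventually.of_forall fun x l hl => ?_
    rw [Real.norm_eq_abs, abs_mul, abs_mul, abs_neg, abs_of_nonneg (f0 x), Real.abs_exp]
    refine mul_le_mul_of_nonneg_left ?_ (f0 x)
    refine mul_le_of_le_one_left (abs_nonneg _) (Real.exp_le_one_iff.2 ?_)
    have := mul_nonneg (le_of_lt (Set.mem_Ioi.1 hl)) (f0 x)
    linarith
  · exact integrable_of_vanishing_past hf hK (by fun_prop) (S := S) fun x hx => by simp [hS _ hx]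
  · refine Filter.Eventually.of_forall fun x l _ => ?_
    have h1 : HasDerivAt (fun l : ℝ => -l * f x) (-1 * f x) l :=
      (hasDerivAt_id l).neg.mul_const _
    convert! h1.exp.mul_const (χ (f x)) using 1
    ring

/-- If `∫ Φ(f)(k - f) + (Φ'(f) + Φ(f)) e = 0` for all cutoff profiles `Φ`, with `0 ≤ e ≤ f`, then
`l ↦ l^k ∫ exp(-l f) χ(f)` is monotone on `(0,1]` for every decreasing cutoff `χ`. -/
theorem rpow_mul_integral_exp_le (hf : Continuous f) (he : Continuous e)
    (e0 : ∀ x, 0 ≤ e x) (ef : ∀ x, e x ≤ f x) (hK : ∀ R, IsCompact {x | f x ≤ R})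
    (H : ∀ Φ : ℝ → ℝ, ContDiff ℝ 1 Φ → (∃ S, ∀ s, S ≤ s → Φ s = 0) →
      ∫ x, Φ (f x) * (k - f x) + (deriv Φ (f x) + Φ (f x)) * e x ∂μ = 0)
    {χ : ℝ → ℝ} (hχ : ContDiff ℝ 1 χ) (χ0 : ∀ s, 0 ≤ χ s) (hχ' : Antitone χ) {S : ℝ}
    (hS : ∀ s, S ≤ s → χ s = 0) {l : ℝ} (hl : 0 < l) (hl1 : l ≤ 1) :
    l ^ k * ∫ x, Real.exp (-l * f x) * χ (f x) ∂μ ≤ ∫ x, Real.exp (-f x) * χ (f x) ∂μ := by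
  have f0 : ∀ x, 0 ≤ f x := fun x => (e0 x).trans (ef x)
  have hc := hχ.continuous
  have hc' : Continuous (deriv χ) := hχ.continuous_deriv le_rfl
  have hder : ∀ l : ℝ, 0 < l → HasDerivAt
      (fun l : ℝ => l ^ k * ∫ x, Real.exp (-l * f x) * χ (f x) ∂μ)
      (k * l ^ (k - 1) * (∫ x, Real.exp (-l * f x) * χ (f x) ∂μ) +
        l ^ k * (∫ x, -f x * (Real.exp (-l * f x) * χ (f x)) ∂μ)) l := fun l hl =>
    (Real.hasDerivAt_rpow_const (Or.inl hl.ne')).mul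
      (hasDerivAt_integral_exp_mul_cutoff hf f0 hK hχ hS hl)
  -- Past `S + 1` there is a whole neighbourhood on which `χ` vanishes.
  have hS1 : ∀ s, S + 1 ≤ s → deriv χ s = 0 := fun s hs => by
    have : χ =ᶠ[nhds s] fun _ => 0 := by
      filter_upwards [Ioi_mem_nhds (show S < s by linarith)] with t ht
      exact hS t (le_of_lt ht)
    rw [this.deriv_eq]; simp
  have hpos : ∀ l : ℝ, 0 < l → l ≤ 1 →
      0 ≤ k * l ^ (k - 1) * (∫ x, Real.exp (-l * f x) * χ (f x) ∂μ) +
        l ^ k * (∫ x, -f x * (Real.exp (-l * f x) * χ (f x)) ∂μ) := by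
    intro l hl hl1
    have hlk : l ^ k = l ^ (k - 1) * l := by
      rw [Real.rpow_sub_one hl.ne']; field_simp
    have hdΦ : ∀ s, HasDerivAt (fun s => Real.exp (-l * s) * χ s)
        (Real.exp (-l * s) * -l * χ s + Real.exp (-l * s) * deriv χ s) s := fun s => by
      have h1 : HasDerivAt (fun s : ℝ => -l * s) (-l) s := by
        simpa using (hasDerivAt_id s).const_mul (-l)
      exact h1.exp.mul ((hχ.differentiable one_ne_zero) s).hasDerivAt
    have hH := H (fun s => Real.exp (-l * s) * χ s)
      ((Real.contDiff_exp.comp (contDiff_const.mul contDiff_id)).mul hχ)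
      ⟨S, fun s hs => by simp [hS s hs]⟩
    simp only [(hdΦ _).deriv] at hH
    have i1 : Integrable (fun x => Real.exp (-l * f x) * χ (f x)) μ :=
      integrable_of_vanishing_past hf hK (by fun_prop) (S := S) fun x hx => by simp [hS _ hx]
    have i2 : Integrable (fun x => -f x * (Real.exp (-l * f x) * χ (f x))) μ :=
      integrable_of_vanishing_past hf hK (by fun_prop) (S := S) fun x hx => by simp [hS _ hx]
    have i4 : Integrable (fun x => Real.exp (-l * f x) * χ (f x) * (k - f x) +
        (Real.exp (-l * f x) * -l * χ (f x) + Real.exp (-l * f x) * deriv χ (f x) +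
          Real.exp (-l * f x) * χ (f x)) * e x) μ :=
      integrable_of_vanishing_past hf hK (by fun_prop) (S := S + 1) fun x hx => by
        simp [hS _ (show S ≤ f x by linarith), hS1 _ hx]
    -- Subtracting the identity `H` for `Φ = exp(-l ·) χ` trades `k - l f` for an integrand with a
    -- sign: `l ≤ 1`, `e ≤ f` and `χ' ≤ 0` make both of its terms contribute nonnegatively.
    have key : k * (∫ x, Real.exp (-l * f x) * χ (f x) ∂μ) +
        l * (∫ x, -f x * (Real.exp (-l * f x) * χ (f x)) ∂μ) =
        ∫ x, Real.exp (-l * f x) *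
          ((1 - l) * χ (f x) * (f x - e x) - deriv χ (f x) * e x) ∂μ := by
      rw [← integral_const_mul, ← integral_const_mul,
        ← integral_add (i1.const_mul k) (i2.const_mul l), ← sub_zero (∫ x, _ ∂μ), ← hH]
      refine (integral_sub ((i1.const_mul k).add (i2.const_mul l)) i4).symm.trans ?_
      congr 1 with x
      simp only [Pi.add_apply]
      ring
    have hn : 0 ≤ ∫ x, Real.exp (-l * f x) *
          ((1 - l) * χ (f x) * (f x - e x) - deriv χ (f x) * e x) ∂μ := by
      refine integral_nonneg fun x => mul_nonneg (Real.exp_pos _).le ?_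
      have h1 : 0 ≤ (1 - l) * χ (f x) * (f x - e x) :=
        mul_nonneg (mul_nonneg (by linarith) (χ0 _)) (by linarith [ef x])
      have h2 : deriv χ (f x) * e x ≤ 0 :=
        mul_nonpos_of_nonpos_of_nonneg hχ'.deriv_nonpos (e0 x)
      linarith
    rw [← key] at hn
    have := mul_nonneg (Real.rpow_pos_of_pos hl (k - 1)).le hn
    rw [hlk]
    linarith
  have hmono : MonotoneOn (fun l : ℝ => l ^ k * ∫ x, Real.exp (-l * f x) * χ (f x) ∂μ)
      (Set.Icc l 1) := by
    refine monotoneOn_of_deriv_nonneg (convex_Icc l 1)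
      (fun s hs => (hder s (hl.trans_le hs.1)).continuousAt.continuousWithinAt)
      (fun s hs => ?_) (fun s hs => ?_)
    · rw [interior_Icc] at hs
      exact (hder s (hl.trans hs.1)).differentiableAt.differentiableWithinAt
    · rw [interior_Icc] at hs
      rw [(hder s (hl.trans hs.1)).deriv]
      exact hpos s (hl.trans hs.1) hs.2.le
  simpa using hmono ⟨le_rfl, hl1⟩ ⟨hl1, le_rfl⟩ hl1

/-- A decreasing `C¹` cutoff: `1` up to `R`, `0` past `R + 1`. -/
theorem exists_antitone_cutoff (R : ℝ) : ∃ χ : ℝ → ℝ, ContDiff ℝ 1 χ ∧ (∀ s, 0 ≤ χ s) ∧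
    (∀ s, χ s ≤ 1) ∧ Antitone χ ∧ (∀ s, s ≤ R → χ s = 1) ∧ ∀ s, R + 1 ≤ s → χ s = 0 :=
  ⟨fun s => Real.smoothTransition (R + 1 - s),
    (Real.smoothTransition.contDiff (n := 1)).comp (contDiff_const.sub contDiff_id),
    fun _ => Real.smoothTransition.nonneg _, fun _ => Real.smoothTransition.le_one _,
    fun _ _ h => Real.smoothTransition.monotone (by linarith),
    fun _ h => Real.smoothTransition.one_of_one_le (by linarith),
    fun _ h => Real.smoothTransition.zero_of_nonpos (by linarith)⟩

/-- Both conclusions come from the monotonicity in `l`: finiteness by absorbing the tail of the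
integral into half of itself, the volume bound by bounding `exp(-l f)` below on a sublevel set. -/
theorem integrable_exp_neg_and_measure_le (hf : Continuous f) (he : Continuous e)
    (e0 : ∀ x, 0 ≤ e x) (ef : ∀ x, e x ≤ f x) (hK : ∀ R, IsCompact {x | f x ≤ R})
    (H : ∀ Φ : ℝ → ℝ, ContDiff ℝ 1 Φ → (∃ S, ∀ s, S ≤ s → Φ s = 0) →
      ∫ x, Φ (f x) * (k - f x) + (deriv Φ (f x) + Φ (f x)) * e x ∂μ = 0) :
    Integrable (fun x => Real.exp (-f x)) μ ∧
      ∀ l : ℝ, 0 < l → l ≤ 1 → μ {x | f x ≤ 1 / (4 * l)} ≤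
        ENNReal.ofReal (Real.exp (1 / 4) * (∫ x, Real.exp (-f x) ∂μ) * l ^ (-k)) := by
  have f0 : ∀ x, 0 ≤ f x := fun x => (e0 x).trans (ef x)
  choose χ χd χ0 χ1 χa χ1' χ0' using exists_antitone_cutoff
  have iχ : ∀ (l R : ℝ), Integrable (fun x => Real.exp (-l * f x) * χ R (f x)) μ := fun l R =>
    integrable_of_vanishing_past hf hK (by have := (χd R).continuous; fun_prop)
      (S := R + 1) fun x hx => by simp [χ0' R _ hx]
  have iχ1 : ∀ (R : ℝ), Integrable (fun x => Real.exp (-f x) * χ R (f x)) μ := fun R => by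
    simpa using iχ 1 R
  have hI : Integrable (fun x => Real.exp (-f x)) μ := by
    -- Where `f ≥ s`, `exp(-f) ≤ exp(-s/2) exp(-f/2)`. With this `s`, monotonicity between `1/2` and
    -- `1` bounds the tail by half of the full cut-off integral.
    obtain ⟨s, hs⟩ : ∃ s : ℝ, Real.exp (-s / 2) ≤ (1 / 2 : ℝ) ^ k / 2 := by
      refine ⟨-2 * Real.log ((1 / 2 : ℝ) ^ k / 2), ?_⟩
      rw [show -(-2 * Real.log ((1 / 2 : ℝ) ^ k / 2)) / 2 = Real.log ((1 / 2 : ℝ) ^ k / 2) by ring,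
        Real.exp_log (by positivity)]
    set M := ∫ x, Real.exp (-f x) * χ s (f x) ∂μ
    have hp : 0 < (1 / 2 : ℝ) ^ k := by positivity
    -- Writing `I` for the left side, the argument is `I ≤ M + I/2`; subtracting is legitimate
    -- because the cutoff makes `I` finite.
    have bound : ∀ R, ∫ x, Real.exp (-f x) * χ R (f x) ∂μ ≤ 2 * M := by
      intro R
      have h1 := rpow_mul_integral_exp_le hf he e0 ef hK H (χd R) (χ0 R) (χa R) (χ0' R)
        (l := 1 / 2) (by norm_num) (by norm_num)
      have h2 : ∫ x, Real.exp (-f x) * χ R (f x) ∂μ ≤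
          ∫ x, Real.exp (-f x) * χ s (f x) +
            Real.exp (-s / 2) * (Real.exp (-(1 / 2) * f x) * χ R (f x)) ∂μ := by
        refine integral_mono (iχ1 R) ((iχ1 s).add ((iχ _ R).const_mul _)) fun x => ?_
        simp only
        rcases le_total (f x) s with h | h
        · rw [χ1' s _ h]
          have a := mul_le_mul_of_nonneg_left (χ1 R (f x)) (Real.exp_pos (-f x)).le
          have b := mul_nonneg (Real.exp_pos (-s / 2)).le
            (mul_nonneg (Real.exp_pos (-(1 / 2) * f x)).le (χ0 R (f x)))
          linarith
        · have a := mul_nonneg (Real.exp_pos (-f x)).le (χ0 s (f x))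
          have b : Real.exp (-f x) ≤ Real.exp (-s / 2) * Real.exp (-(1 / 2) * f x) := by
            rw [← Real.exp_add]
            exact Real.exp_le_exp.2 (by linarith)
          have c := mul_le_mul_of_nonneg_right b (χ0 R (f x))
          linarith
      rw [integral_add (iχ1 s) ((iχ _ R).const_mul _), integral_const_mul] at h2
      have h3 : 0 ≤ ∫ x, Real.exp (-(1 / 2) * f x) * χ R (f x) ∂μ :=
        integral_nonneg fun x => mul_nonneg (Real.exp_pos _).le (χ0 R _)
      have h4 := mul_le_mul_of_nonneg_right hs h3
      have h5 : (1 / 2 : ℝ) ^ k / 2 * ∫ x, Real.exp (-(1 / 2) * f x) * χ R (f x) ∂μ =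
        ((1 / 2 : ℝ) ^ k * ∫ x, Real.exp (-(1 / 2) * f x) * χ R (f x) ∂μ) / 2 := by ring
      change _ ≤ M + _ at h2
      linarith
    have hc : Continuous fun x => Real.exp (-f x) := by fun_prop
    have hcov : AECover μ Filter.atTop (fun m : ℕ => {x | f x ≤ m}) :=
      { ae_eventually_mem := Filter.Eventually.of_forall fun x => by
          filter_upwards [Filter.eventually_ge_atTop ⌈f x⌉₊] with m hm
          exact (Nat.le_ceil _).trans (by exact_mod_cast hm)
        measurableSet := fun m => (isClosed_le hf continuous_const).measurableSet }
    refine hcov.integrable_of_integral_norm_bounded (2 * M)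
      (fun m => hc.continuousOn.integrableOn_compact' (hK m)
        (isClosed_le hf continuous_const).measurableSet) (Filter.Eventually.of_forall fun m => ?_)
    refine le_trans ?_ (bound m)
    rw [← integral_indicator (isClosed_le hf continuous_const).measurableSet]
    refine integral_mono ((hc.norm.continuousOn.integrableOn_compact' (hK m)
        (isClosed_le hf continuous_const).measurableSet).integrable_indicator
        (isClosed_le hf continuous_const).measurableSet) (iχ1 m) fun x => ?_
    by_cases hx : f x ≤ m
    · simp [Set.indicator, hx, χ1' _ _ hx]
    · simp only [Set.indicator, Set.mem_ofPred_eq, hx, if_false]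
      exact mul_nonneg (Real.exp_pos _).le (χ0 _ _)
  refine ⟨hI, fun l hl hl1 => ?_⟩
  -- This level satisfies `l R = 1/4`, hence `exp(-l f) ≥ exp(-1/4)` on `{f ≤ R}`.
  set R := 1 / (4 * l)
  have hm : MeasurableSet {x | f x ≤ R} := (isClosed_le hf continuous_const).measurableSet
  have hfin : μ {x | f x ≤ R} ≠ ⊤ := (hK R).measure_lt_top.ne
  rw [← ENNReal.ofReal_toReal hfin]
  refine ENNReal.ofReal_le_ofReal ?_
  have h1 := rpow_mul_integral_exp_le hf he e0 ef hK H (χd R) (χ0 R) (χa R) (χ0' R) hl hl1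
  have h2 : ∫ x, Real.exp (-f x) * χ R (f x) ∂μ ≤ ∫ x, Real.exp (-f x) ∂μ :=
    integral_mono (iχ1 R) hI fun x => mul_le_of_le_one_right (Real.exp_pos _).le (χ1 R _)
  have h3 : Real.exp (-(1 / 4)) * (μ {x | f x ≤ R}).toReal ≤
      ∫ x, Real.exp (-l * f x) * χ R (f x) ∂μ := by
    have : Real.exp (-(1 / 4)) * (μ {x | f x ≤ R}).toReal =
        ∫ x, {x | f x ≤ R}.indicator (fun _ => Real.exp (-(1 / 4))) x ∂μ := by
      rw [integral_indicator hm, setIntegral_const, smul_eq_mul, mul_comm]; rfl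
    rw [this]
    refine integral_mono ((integrable_indicator_iff hm).2 (integrableOn_const hfin))
      (iχ l R) fun x => ?_
    by_cases hx : f x ≤ R
    · simp only [Set.indicator, Set.mem_ofPred_eq, hx, if_true, χ1' _ _ hx, mul_one]
      refine Real.exp_le_exp.2 ?_
      have := mul_le_mul_of_nonneg_left hx hl.le
      have h4 : l * R = 1 / 4 := by simp only [R]; field_simp
      linarith
    · simp only [Set.indicator, Set.mem_ofPred_eq, hx, if_false]
      exact mul_nonneg (Real.exp_pos _).le (χ0 _ _)
  have hlk : 0 < l ^ k := Real.rpow_pos_of_pos hl k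
  have h4 := (mul_le_mul_of_nonneg_left h3 hlk.le).trans (h1.trans h2)
  rw [Real.rpow_neg hl.le]
  have h5 : (μ {x | f x ≤ R}).toReal = Real.exp (1 / 4) *
      (l ^ k * (Real.exp (-(1 / 4)) * (μ {x | f x ≤ R}).toReal)) * (l ^ k)⁻¹ := by
    rw [Real.exp_neg]; field_simp
  rw [h5]
  gcongr

end WeightedVolume

end ContactGraph

namespace ContactGraph

variable {n : ℕ}

/-! ### Rules for partial derivatives. -/

section PartialDerivatives

theorem contDiff_pd {E : Type*} [NormedAddCommGroup E] [NormedSpace ℝ E]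
    {F : (Fin n → ℝ) → E} (hF : ContDiff ℝ ∞ F) (i : Fin n) : ContDiff ℝ ∞ (pd i F) :=
  (hF.fderiv_right (m := ∞) (mod_cast le_top)).clm_apply contDiff_const

theorem pd_comm {F : (Fin n → ℝ) → ℝ} (hF : ContDiff ℝ ∞ F) (i j : Fin n) (x : Fin n → ℝ) :
    pd i (pd j F) x = pd j (pd i F) x := by
  have hd : DifferentiableAt ℝ (fderiv ℝ F) x :=
    (hF.fderiv_right (m := ∞) (mod_cast le_top)).differentiable (by simp) x
  have h : ∀ i j : Fin n, pd i (pd j F) x =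
      fderiv ℝ (fderiv ℝ F) x (Pi.single i 1) (Pi.single j 1) := fun i j => by
    unfold pd
    rw [fderiv_clm_apply hd (differentiableAt_const _)]
    simp
  rw [h, h]
  exact ((contDiff_infty.1 hF 2).contDiffAt.isSymmSndFDerivAt (by simp)).eq _ _

theorem pd_pi_apply {κ : Type*} [Fintype κ] {F : (Fin n → ℝ) → κ → ℝ} {x : Fin n → ℝ}
    (hF : DifferentiableAt ℝ F x) (i : Fin n) (a : κ) : pd i F x a = pd i (fun y => F y a) x := by
  unfold pd
  rw [fderiv_apply hF a]
  rfl

theorem pd_add {F H : (Fin n → ℝ) → ℝ} {x : Fin n → ℝ} (hF : DifferentiableAt ℝ F x)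
    (hH : DifferentiableAt ℝ H x) (i : Fin n) :
    pd i (fun y => F y + H y) x = pd i F x + pd i H x := by
  unfold pd; rw [fderiv_fun_add hF hH]; rfl

theorem pd_mul {F H : (Fin n → ℝ) → ℝ} {x : Fin n → ℝ} (hF : DifferentiableAt ℝ F x)
    (hH : DifferentiableAt ℝ H x) (i : Fin n) :
    pd i (fun y => F y * H y) x = F x * pd i H x + pd i F x * H x := by
  unfold pd; rw [fderiv_fun_mul hF hH]; simp [mul_comm]

theorem pd_sum {κ : Type*} {s : Finset κ} {F : κ → (Fin n → ℝ) → ℝ} {x : Fin n → ℝ}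
    (hF : ∀ a ∈ s, DifferentiableAt ℝ (F a) x) (i : Fin n) :
    pd i (fun y => ∑ a ∈ s, F a y) x = ∑ a ∈ s, pd i (F a) x := by
  unfold pd; rw [fderiv_fun_sum hF]; simp

theorem pd_const (c : ℝ) (i : Fin n) (x : Fin n → ℝ) : pd i (fun _ => c) x = 0 := by
  simp [pd]

theorem pd_coord (i j : Fin n) (x : Fin n → ℝ) :
    pd i (fun y => y j) x = (1 : Matrix (Fin n) (Fin n) ℝ) i j := by
  unfold pd
  rw [show (fun y : Fin n → ℝ => y j) = ContinuousLinearMap.proj (R := ℝ) (φ := fun _ => ℝ) j from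
    rfl, ContinuousLinearMap.fderiv]
  simp [Matrix.one_apply, Pi.single_apply, eq_comm]

end PartialDerivatives

/-! ### The contact metric and its connection on horizontal vectors. -/

section ContactGeometry

theorem contactForm_add (p v w : Space n) :
    contactForm p (v + w) = contactForm p v + contactForm p w := by
  simp only [contactForm, zc, xc, yc, Pi.add_apply, mul_add, add_sub_add_comm,
    Finset.sum_add_distrib]

theorem contactForm_smul (p v : Space n) (c : ℝ) :
    contactForm p (c • v) = c * contactForm p v := by
  simp only [contactForm, zc, xc, yc, Pi.smul_apply, smul_eq_mul, mul_sub, Finset.mul_sum]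
  ring_nf

/-- The metric as a linear form in its second vector. -/
noncomputable def metricForm (p v : Space n) : Space n →ₗ[ℝ] ℝ where
  toFun w := metric p v w
  map_add' w w' := by
    simp only [metric, contactForm_add, xc, yc, Pi.add_apply, mul_add, Finset.sum_add_distrib]
    ring
  map_smul' c w := by
    simp only [metric, contactForm_smul, xc, yc, Pi.smul_apply, smul_eq_mul, RingHom.id_apply,
      mul_add, Finset.mul_sum]
    congr 1
    · exact Finset.sum_congr rfl fun i _ => by ring
    · ring

@[simp] theorem metricForm_apply (p v w : Space n) : metricForm p v w = metric p v w := rfl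

/-- The derivative of the contact form with respect to its base point. -/
theorem fderiv_contactForm (p a v : Space n) :
    fderiv ℝ (fun q => contactForm q v) p a =
      -(1 / 4) * ∑ i, (yc a i * xc v i - xc a i * yc v i) := by
  have h : (fun q : Space n => contactForm q v) = fun q => (1 / 2) * zc v +
      (-(1 / 4 : ℝ) • ∑ i, (xc v i • ContinuousLinearMap.proj (R := ℝ) (φ := fun _ => ℝ)
        (Sum.inr (Sum.inl i)) - yc v i • ContinuousLinearMap.proj (R := ℝ) (φ := fun _ => ℝ)
        (Sum.inl i)) : Space n →L[ℝ] ℝ) q := by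
    ext q
    simp only [contactForm, smul_apply, sum_apply,
      sub_apply, ContinuousLinearMap.proj_apply, smul_eq_mul, xc, yc,
      mul_comm (v _)]
    ring
  rw [h, fderiv_const_add, ContinuousLinearMap.fderiv]
  simp [xc, yc, mul_comm (v _)]

theorem differentiable_contactForm (v : Space n) :
    Differentiable ℝ fun q : Space n => contactForm q v := by
  unfold contactForm xc yc zc
  fun_prop

theorem fderiv_metric (p a v w : Space n) :
    fderiv ℝ (fun q => metric q v w) p a =
      contactForm p v * fderiv ℝ (fun q => contactForm q w) p a +
        contactForm p w * fderiv ℝ (fun q => contactForm q v) p a := by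
  unfold metric
  rw [fderiv_const_add,
    fderiv_fun_mul (differentiable_contactForm v p) (differentiable_contactForm w p)]
  rfl

/-- The Christoffel expression vanishes on pairs of horizontal vectors, since the derivative of
the contact form is skew-symmetric. -/
theorem christoffel_eq_zero {p v w : Space n} (hv : contactForm p v = 0)
    (hw : contactForm p w = 0) : christoffel p v w = 0 := by
  unfold christoffel
  -- The covector itself vanishes, so nothing about the inverse metric is needed: the first two
  -- derivatives leave `η(∂_c)` times a skew expression in `v, w` plus its swap, and the third has a
  -- factor `η(v)` or `η(w)` in each term.
  refine (congrArg (_ *ᵥ ·) (?_ : _ = (0 : Space n))).trans (Matrix.mulVec_zero _)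
  ext c
  have h : (∑ i, (yc v i * xc w i - xc v i * yc w i)) =
      -∑ i, (yc w i * xc v i - xc w i * yc v i) := by
    rw [← Finset.sum_neg_distrib]
    exact Finset.sum_congr rfl fun i _ => by ring
  simp only [fderiv_metric, hv, hw, fderiv_contactForm, h, Pi.zero_apply]
  ring

end ContactGeometry

/-! ### Geometry of the Legendrian graph and the shrinker equation in terms of `u`. -/

section Graph

/-- The gradient of `u`. -/
noncomputable def grad (u : (Fin n → ℝ) → ℝ) (x : Fin n → ℝ) : Fin n → ℝ := fun i => pd i u x

/-- The Hessian matrix of `u`. -/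
noncomputable def hess (u : (Fin n → ℝ) → ℝ) (x : Fin n → ℝ) : Matrix (Fin n) (Fin n) ℝ :=
  Matrix.of fun i j => pd i (pd j u) x

/-- The derivative of the Hessian matrix of `u` in the direction of the `k`-th coordinate. -/
noncomputable def third (u : (Fin n → ℝ) → ℝ) (k : Fin n) (x : Fin n → ℝ) :
    Matrix (Fin n) (Fin n) ℝ :=
  Matrix.of fun i j => pd k (fun y => hess u y i j) x

/-- Four times the induced metric of the graph: `1 + (D²u)²`. -/
noncomputable def gram (u : (Fin n → ℝ) → ℝ) (x : Fin n → ℝ) : Matrix (Fin n) (Fin n) ℝ :=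
  1 + hess u x * hess u x

variable {u : (Fin n → ℝ) → ℝ}

theorem contDiff_hess (hu : ContDiff ℝ ∞ u) (i j : Fin n) : ContDiff ℝ ∞ fun x => hess u x i j :=
  contDiff_pd (contDiff_pd hu j) i

theorem hess_transpose (hu : ContDiff ℝ ∞ u) (x : Fin n → ℝ) : (hess u x)ᵀ = hess u x := by
  ext i j; exact pd_comm hu _ _ _

theorem hess_symm (hu : ContDiff ℝ ∞ u) (x : Fin n → ℝ) (i j : Fin n) :
    hess u x i j = hess u x j i := pd_comm hu _ _ _

theorem third_transpose (hu : ContDiff ℝ ∞ u) (k : Fin n) (x : Fin n → ℝ) :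
    (third u k x)ᵀ = third u k x := by
  ext i j
  change pd k (fun y => hess u y j i) x = pd k (fun y => hess u y i j) x
  simp_rw [hess_symm hu _ j i]

/-- With `third_transpose` this makes the third derivatives of `u` totally symmetric, the Codazzi
property used in the divergence computation. -/
theorem third_swap (hu : ContDiff ℝ ∞ u) (k i j : Fin n) (x : Fin n → ℝ) :
    third u k x i j = third u i x k j := pd_comm (contDiff_pd hu j) _ _ _

theorem gram_posDef (hu : ContDiff ℝ ∞ u) (x : Fin n → ℝ) : (gram u x).PosDef := by
  have h := Matrix.posSemidef_conjTranspose_mul_self (hess u x)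
  rw [Matrix.conjTranspose_eq_transpose_of_trivial, hess_transpose hu] at h
  exact Matrix.PosDef.one.add_posSemidef h

theorem contDiff_height (hu : ContDiff ℝ ∞ u) : ContDiff ℝ ∞ (height u) := by
  have : ∀ i, ContDiff ℝ ∞ (pd i u) := contDiff_pd hu
  unfold height
  fun_prop

theorem contDiff_position (hu : ContDiff ℝ ∞ u) : ContDiff ℝ ∞ (position u) := by
  rw [contDiff_pi]
  rintro (i | i | i)
  · exact contDiff_apply ℝ ℝ i
  · exact contDiff_pd hu i
  · exact contDiff_height hu

theorem pd_height (hu : ContDiff ℝ ∞ u) (i : Fin n) (x : Fin n → ℝ) :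
    pd i (height u) x = (1 / 2) * (pd i u x - ∑ j, hess u x i j * x j) := by
  have d : ∀ j, Differentiable ℝ (pd j u) := fun j => (contDiff_pd hu j).differentiable (by simp)
  have du : Differentiable ℝ u := hu.differentiable (by simp)
  have h : height u = fun y => u y + (-(1 / 2)) * ∑ j, y j * pd j u y := by
    ext y; unfold height; ring
  rw [h, pd_add (du x) (by fun_prop), pd_mul (by fun_prop) (by fun_prop), pd_const,
    pd_sum fun j _ => by fun_prop]
  have : ∀ j, pd i (fun y => y j * pd j u y) x =
      x j * hess u x i j + (1 : Matrix (Fin n) (Fin n) ℝ) i j * pd j u x := fun j => by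
    rw [pd_mul (by fun_prop) (d j x), pd_coord]; rfl
  simp only [this, Finset.sum_add_distrib, Matrix.one_apply, ite_mul, one_mul, zero_mul,
    Finset.sum_ite_eq, Finset.mem_univ, if_true, mul_comm (x _)]
  ring

theorem xc_tangentVec (hu : ContDiff ℝ ∞ u) (i j : Fin n) (x : Fin n → ℝ) :
    xc (tangentVec u i x) j = (1 : Matrix (Fin n) (Fin n) ℝ) i j := by
  unfold tangentVec xc
  rw [pd_pi_apply ((contDiff_position hu).differentiable (by simp) x)]
  exact pd_coord i j x

theorem yc_tangentVec (hu : ContDiff ℝ ∞ u) (i j : Fin n) (x : Fin n → ℝ) :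
    yc (tangentVec u i x) j = hess u x i j := by
  unfold tangentVec yc
  rw [pd_pi_apply ((contDiff_position hu).differentiable (by simp) x)]
  rfl

theorem zc_tangentVec (hu : ContDiff ℝ ∞ u) (i : Fin n) (x : Fin n → ℝ) :
    zc (tangentVec u i x) = (1 / 2) * (pd i u x - ∑ j, hess u x i j * x j) := by
  rw [← pd_height hu]
  unfold tangentVec zc
  rw [pd_pi_apply ((contDiff_position hu).differentiable (by simp) x)]
  rfl

theorem xc_position (x : Fin n → ℝ) (i : Fin n) : xc (position u x) i = x i := rfl

theorem yc_position (x : Fin n → ℝ) (i : Fin n) : yc (position u x) i = pd i u x := rfl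

/-- The graph is Legendrian. -/
theorem contactForm_tangentVec (hu : ContDiff ℝ ∞ u) (i : Fin n) (x : Fin n → ℝ) :
    contactForm (position u x) (tangentVec u i x) = 0 := by
  unfold contactForm
  simp only [zc_tangentVec hu, xc_tangentVec hu, yc_tangentVec hu, xc_position, yc_position,
    Finset.sum_sub_distrib, Matrix.one_apply, mul_ite, mul_one, mul_zero, Finset.sum_ite_eq,
    Finset.mem_univ, if_true, mul_comm (x _)]
  ring

theorem inducedMetric_eq (hu : ContDiff ℝ ∞ u) (x : Fin n → ℝ) :
    inducedMetric u x = (1 / 4 : ℝ) • gram u x := by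
  ext i j
  simp only [inducedMetric, Matrix.of_apply, metric, contactForm_tangentVec hu, xc_tangentVec hu,
    yc_tangentVec hu, gram, Matrix.smul_apply, Matrix.add_apply, Matrix.mul_apply, smul_eq_mul,
    Finset.sum_add_distrib, mul_zero, add_zero, hess_symm hu x j]
  simp [Matrix.one_apply]

theorem inducedMetric_inv (hu : ContDiff ℝ ∞ u) (x : Fin n → ℝ) :
    (inducedMetric u x)⁻¹ = (4 : ℝ) • (gram u x)⁻¹ := by
  rw [inducedMetric_eq hu]
  refine Matrix.inv_eq_left_inv ?_
  rw [Matrix.smul_mul, Matrix.mul_smul, smul_smul,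
    Matrix.nonsing_inv_mul _ (gram_posDef hu x).det_pos.ne'.isUnit]
  norm_num

theorem covDeriv_eq (hu : ContDiff ℝ ∞ u) (i j : Fin n) (x : Fin n → ℝ) :
    covDeriv u i j x = pd i (tangentVec u j) x := by
  unfold covDeriv
  rw [christoffel_eq_zero (contactForm_tangentVec hu i x) (contactForm_tangentVec hu j x), add_zero]

/-- The horizontal normal vector of the graph over `(-D²u eₖ, eₖ)`. -/
noncomputable def normalVec (u : (Fin n → ℝ) → ℝ) (k : Fin n) (x : Fin n → ℝ) : Space n :=
  Sum.elim (fun i => -hess u x k i) (Sum.elim (fun i => (1 : Matrix (Fin n) (Fin n) ℝ) k i)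
    (fun _ => -(1 / 2) * (x k + ∑ i, pd i u x * hess u x k i)))

theorem contactForm_normalVec (k : Fin n) (x : Fin n → ℝ) :
    contactForm (position u x) (normalVec u k x) = 0 := by
  have h1 : ∀ i, xc (normalVec u k x) i = -hess u x k i := fun _ => rfl
  have h2 : ∀ i, yc (normalVec u k x) i = (1 : Matrix (Fin n) (Fin n) ℝ) k i := fun _ => rfl
  have h3 : zc (normalVec u k x) = -(1 / 2) * (x k + ∑ i, pd i u x * hess u x k i) := rfl
  unfold contactForm
  simp only [h1, h2, h3, xc_position, yc_position, Matrix.one_apply, mul_neg,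
    Finset.sum_sub_distrib, Finset.sum_neg_distrib, mul_ite, mul_one, mul_zero, Finset.sum_ite_eq,
    Finset.mem_univ, if_true]
  ring

/-- Only the flat part of the metric survives because `normalVec` is horizontal; the `z`-component
of `w` plays no role. -/
theorem metric_normalVec (k : Fin n) (x : Fin n → ℝ) (w : Space n) :
    metric (position u x) (normalVec u k x) w =
      (1 / 4) * (yc w k - ∑ i, hess u x k i * xc w i) := by
  have h1 : ∀ i, xc (normalVec u k x) i = -hess u x k i := fun _ => rfl
  have h2 : ∀ i, yc (normalVec u k x) i = (1 : Matrix (Fin n) (Fin n) ℝ) k i := fun _ => rfl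
  simp only [metric, contactForm_normalVec, h1, h2, Finset.sum_add_distrib, Matrix.one_apply,
    neg_mul, Finset.sum_neg_distrib, ite_mul, one_mul, zero_mul, Finset.sum_ite_eq,
    Finset.mem_univ, if_true]
  ring

theorem metric_normalVec_tangentVec (hu : ContDiff ℝ ∞ u) (k i : Fin n) (x : Fin n → ℝ) :
    metric (position u x) (normalVec u k x) (tangentVec u i x) = 0 := by
  rw [metric_normalVec]
  simp [xc_tangentVec hu, yc_tangentVec hu, Matrix.one_apply, hess_symm hu x i k]

theorem metric_normalVec_normalPart (hu : ContDiff ℝ ∞ u) (k : Fin n) (x : Fin n → ℝ)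
    (w : Space n) : metric (position u x) (normalVec u k x) (normalPart u x w) =
      metric (position u x) (normalVec u k x) w := by
  rw [← metricForm_apply, normalPart, map_sub, map_sum]
  simp [metric_normalVec_tangentVec hu]

/-- The `x`-components of the tangent frame are constant and its `y`-components are Hessian entries,
so the second fundamental form is given by third derivatives of `u`. -/
theorem metric_normalVec_covDeriv (hu : ContDiff ℝ ∞ u) (k i j : Fin n) (x : Fin n → ℝ) :
    metric (position u x) (normalVec u k x) (covDeriv u i j x) = (1 / 4) * third u k x i j := by
  have d : Differentiable ℝ (tangentVec u j) :=
    (contDiff_pd (contDiff_position hu) j).differentiable (by simp)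
  have hx : ∀ l, xc (pd i (tangentVec u j) x) l = 0 := fun l => by
    unfold xc
    rw [pd_pi_apply (d x)]
    exact (congrArg (fun F => pd i F x) (funext fun y => xc_tangentVec hu j l y)).trans
      (pd_const _ _ _)
  have hy : yc (pd i (tangentVec u j) x) k = third u k x i j := by
    unfold yc
    rw [pd_pi_apply (d x)]
    refine (congrArg (fun F => pd i F x) (funext fun y => yc_tangentVec hu j k y)).trans ?_
    have h : third u i x j k = third u i x k j :=
      congrFun (congrFun (third_transpose hu i x) k) j
    exact h.trans (third_swap hu i k j x)
  rw [covDeriv_eq hu, metric_normalVec, hy]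
  simp [hx]

/-- The self-shrinker equation as a third order equation for `u`. -/
theorem IsSelfShrinker.trace_third {θ : (Fin n → ℝ) → ℝ} (h : IsSelfShrinker u θ)
    (hu : ContDiff ℝ ∞ u) (k : Fin n) (x : Fin n → ℝ) :
    ∑ i, ∑ j, (gram u x)⁻¹ i j * third u k x i j =
      -(1 / 8) * (grad u x k - ∑ i, hess u x k i * x i) := by
  have h1 := congrArg (metricForm (position u x) (normalVec u k x)) (h x)
  -- The Reeb field is orthogonal to horizontal vectors, so `θ` disappears.
  have hr : metric (position u x) (normalVec u k x) (reeb n) = 0 := by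
    rw [metric_normalVec]; simp [reeb, xc, yc]
  simp only [meanCurvature, map_sub, map_sum, map_smul, metricForm_apply,
    metric_normalVec_normalPart hu, metric_normalVec_covDeriv hu, hr, inducedMetric_inv hu,
    Matrix.smul_apply, smul_eq_mul, mul_zero, sub_zero] at h1
  rw [metric_normalVec] at h1
  simp only [xc_position, yc_position] at h1
  have h2 : ∀ i j, 4 * (gram u x)⁻¹ i j * (1 / 4 * third u k x i j) =
      (gram u x)⁻¹ i j * third u k x i j := fun i j => by ring
  simp only [h2] at h1
  rw [h1, grad]
  ring

/-- Since `η(X) = V/2`, the subtracted `V²/4` cancels exactly the `η ⊗ η` part of `|X|²`. -/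
theorem potential_eq (x : Fin n → ℝ) :
    potential u x = (1 / 16) * (x ⬝ᵥ x + grad u x ⬝ᵥ grad u x) := by
  have hc : contactForm (position u x) (position u x) = (1 / 2) * height u x := by
    unfold contactForm
    simp [xc_position, yc_position, mul_comm]
    rfl
  unfold potential metric
  rw [hc]
  simp only [xc_position, yc_position, dotProduct, grad, Finset.sum_add_distrib]
  ring

end Graph

end ContactGraph

namespace ContactGraph

variable {n : ℕ}

/-! ### Smoothness and derivatives of determinants and inverses. -/

section MatrixCalculus

variable {E : Type*} [NormedAddCommGroup E] [NormedSpace ℝ E] {m : Type*} [Fintype m]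
  [DecidableEq m]

theorem contDiff_det {M : E → Matrix m m ℝ} (hM : ∀ i j, ContDiff ℝ ∞ fun x => M x i j) :
    ContDiff ℝ ∞ fun x => (M x).det := by
  simp only [Matrix.det_apply']
  exact ContDiff.sum fun σ _ => contDiff_const.mul (contDiff_prod fun i _ => hM _ _)

theorem contDiff_inv {M : E → Matrix m m ℝ} (hM : ∀ i j, ContDiff ℝ ∞ fun x => M x i j)
    (h0 : ∀ x, (M x).det ≠ 0) (i j : m) : ContDiff ℝ ∞ fun x => (M x)⁻¹ i j := by
  simp only [Matrix.inv_def, Ring.inverse_eq_inv', Matrix.smul_apply, smul_eq_mul,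
    Matrix.adjugate_apply]
  refine ((contDiff_det hM).inv h0).mul (contDiff_det fun a b => ?_)
  by_cases h : a = j
  · subst h; simpa using contDiff_const
  · simpa [h] using hM a b

theorem pd_prod {κ : Type*} [DecidableEq κ] (s : Finset κ) {F : κ → (Fin n → ℝ) → ℝ}
    {x : Fin n → ℝ} (hF : ∀ a, DifferentiableAt ℝ (F a) x) (k : Fin n) :
    pd k (fun y => ∏ a ∈ s, F a y) x =
      ∑ a ∈ s, (∏ b ∈ s.erase a, F b x) * pd k (F a) x := by
  unfold pd
  rw [(HasFDerivAt.finsetProd fun a _ => (hF a).hasFDerivAt).fderiv]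
  simp

/-- **Jacobi's formula** for the derivative of a determinant. -/
theorem pd_det {M : (Fin n → ℝ) → Matrix m m ℝ} {x : Fin n → ℝ}
    (hM : ∀ i j, DifferentiableAt ℝ (fun y => M y i j) x) (k : Fin n) :
    pd k (fun y => (M y).det) x =
      ((M x).adjugate * Matrix.of fun i j => pd k (fun y => M y i j) x).trace := by
  set D : Matrix m m ℝ := Matrix.of fun i j => pd k (fun y => M y i j) x
  -- By Cramer's rule the trace is the sum of determinants with one column differentiated, which the
  -- product rule matches term by term in the permutation expansion.
  have h1 : ((M x).adjugate * D).trace = ∑ i, ((M x).updateCol i fun a => D a i).det := by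
    simp only [Matrix.trace, Matrix.diag, ← Matrix.cramer_apply]
    exact Finset.sum_congr rfl fun i _ => by
      rw [Matrix.cramer_eq_adjugate_mulVec]; rfl
  rw [h1]
  have hd : ∀ σ : Equiv.Perm m, DifferentiableAt ℝ (fun y => ∏ i, M y (σ i) i) x := fun σ =>
    (HasFDerivAt.finsetProd fun i _ => (hM (σ i) i).hasFDerivAt).differentiableAt
  simp only [Matrix.det_apply']
  rw [Finset.sum_comm, pd_sum fun σ _ => (hd σ).const_mul _]
  refine Finset.sum_congr rfl fun σ _ => ?_
  rw [pd_mul (by fun_prop) (hd σ), pd_const,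
    pd_prod _ fun a => hM _ _, zero_mul, add_zero, ← Finset.mul_sum]
  congr 1
  refine Finset.sum_congr rfl fun i _ => ?_
  rw [← Finset.mul_prod_erase _ _ (Finset.mem_univ i), Matrix.updateCol_self, mul_comm]
  congr 1
  exact Finset.prod_congr rfl fun b hb => by
    rw [Matrix.updateCol_ne (Finset.ne_of_mem_erase hb)]

end MatrixCalculus

/-- The algebraic identity behind the divergence of the tangential part of the position vector of
a self-shrinking Lagrangian graph. -/
theorem trace_add_half_trace_eq {A G : Matrix (Fin n) (Fin n) ℝ} (hA : Aᵀ = A)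
    (hG : G = 1 + A * A) (hGu : IsUnit G.det) {T : Fin n → Matrix (Fin n) (Fin n) ℝ}
    (hT : ∀ k, (T k)ᵀ = T k) (hs : ∀ k i j, T k i j = T i k j) {x p q : Fin n → ℝ}
    (hq : G *ᵥ q = x + A *ᵥ p) {Q : Fin n → Fin n → ℝ}
    (hQ : ∀ k, (T k * A + A * T k) *ᵥ q + G *ᵥ Q k =
      G *ᵥ Pi.single k 1 + T k *ᵥ p)
    (hh : ∀ k, ∑ i, ∑ j, G⁻¹ i j * T k i j = -(1 / 8) * (p k - ∑ i, A k i * x i)) :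
    ∑ k, Q k k + ∑ k, (1 / 2) * (G⁻¹ * (T k * A + A * T k)).trace * q k =
      n - (1 / 8) * (x ⬝ᵥ x + p ⬝ᵥ p - q ⬝ᵥ (x + A *ᵥ p)) := by
  have hT' : ∀ k i j, T k i j = T j k i := fun k i j => by
    rw [hs j k i]; exact congrFun (congrFun (hT k) j) i
  have hcomm : A * G⁻¹ = G⁻¹ * A := by
    have h1 : G * A = A * G := by rw [hG]; noncomm_ring
    calc A * G⁻¹ = G⁻¹ * (G * A) * G⁻¹ := by
          rw [← Matrix.mul_assoc, Matrix.nonsing_inv_mul _ hGu, Matrix.one_mul]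
      _ = G⁻¹ * A := by
          rw [h1, Matrix.mul_assoc, Matrix.mul_assoc, Matrix.mul_nonsing_inv _ hGu, Matrix.mul_one]
  -- The normal coefficient: `hq` gives `(x, p) - (q, A q) = (-A s, s)`.
  set s := p - A *ᵥ q with hsdef
  have hQk : ∀ k, Q k = Pi.single k 1 + G⁻¹ *ᵥ (T k *ᵥ s) - (G⁻¹ * A) *ᵥ (T k *ᵥ q) := by
    intro k
    have h1 : G *ᵥ Q k = G *ᵥ Pi.single k 1 + T k *ᵥ s - A *ᵥ (T k *ᵥ q) := by
      rw [eq_sub_of_add_eq' (hQ k), hsdef, Matrix.add_mulVec, Matrix.mulVec_sub,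
        Matrix.mulVec_mulVec, Matrix.mulVec_mulVec]
      abel
    have h2 := congrArg (G⁻¹ *ᵥ ·) h1
    simpa only [Matrix.mulVec_sub, Matrix.mulVec_add, Matrix.mulVec_mulVec,
      Matrix.nonsing_inv_mul _ hGu, Matrix.one_mulVec, Matrix.mul_assoc] using h2
  -- Total symmetry of `T` moves the free index out of the contraction; for `M = G⁻¹` what remains
  -- is the trace in `hh`.
  have contr : ∀ (M : Matrix (Fin n) (Fin n) ℝ) (v : Fin n → ℝ),
      ∑ k, (M *ᵥ (T k *ᵥ v)) k = ∑ j, (∑ k, ∑ i, M k i * T j k i) * v j := by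
    intro M v
    simp only [Matrix.mulVec, dotProduct, Finset.mul_sum, Finset.sum_mul]
    calc ∑ k, ∑ i, ∑ j, M k i * (T k i j * v j)
        = ∑ k, ∑ i, ∑ j, M k i * T j k i * v j := by
          refine Finset.sum_congr rfl fun k _ => Finset.sum_congr rfl fun i _ =>
            Finset.sum_congr rfl fun j _ => ?_
          rw [hT' k i j]; ring
      _ = ∑ k, ∑ j, ∑ i, M k i * T j k i * v j :=
          Finset.sum_congr rfl fun k _ => Finset.sum_comm
      _ = _ := Finset.sum_comm
  -- The volume density term; it cancels the `G⁻¹ * A` term of `hQk`.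
  have htr : ∀ k, (1 / 2 : ℝ) * (G⁻¹ * (T k * A + A * T k)).trace =
      ∑ i, ∑ j, (G⁻¹ * A) i j * T k i j := by
    intro k
    have h1 : (G⁻¹ * (T k * A)).trace = (G⁻¹ * A * T k).trace := by
      rw [← Matrix.mul_assoc, Matrix.trace_mul_comm, ← Matrix.mul_assoc, hcomm]
    have h2 : (G⁻¹ * A * T k).trace = ∑ i, ∑ j, (G⁻¹ * A) i j * T k i j := by
      simp only [Matrix.trace, Matrix.diag]
      refine Finset.sum_congr rfl fun i _ => ?_
      rw [Matrix.mul_apply]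
      refine Finset.sum_congr rfl fun j _ => ?_
      rw [show T k j i = T k i j from congrFun (congrFun (hT k) i) j]
    rw [Matrix.mul_add, Matrix.trace_add, h1, ← Matrix.mul_assoc, ← h2]
    ring
  have hdot : ∀ v w : Fin n → ℝ, v ⬝ᵥ (A *ᵥ w) = (A *ᵥ v) ⬝ᵥ w := fun v w => by
    rw [Matrix.dotProduct_mulVec, ← Matrix.mulVec_transpose, hA]
  have hsum : ∑ k, Q k k = n + s ⬝ᵥ (-(1 / 8 : ℝ) • (p - A *ᵥ x)) -
      ∑ k, (∑ i, ∑ j, (G⁻¹ * A) i j * T k i j) * q k := by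
    simp only [hQk, Pi.add_apply, Pi.sub_apply, Finset.sum_add_distrib, Finset.sum_sub_distrib,
      contr, hh]
    congr 2
    · simp
    · simp only [dotProduct, Pi.smul_apply, Pi.sub_apply, smul_eq_mul, Matrix.mulVec]
      exact Finset.sum_congr rfl fun i _ => by ring
  simp only [htr, hsum]
  -- It remains to see that `s · (p - A x) = |x|² + |p|² - q · (x + A p)`, which follows from `hq`
  -- paired with `x`.
  have hx := congrArg (x ⬝ᵥ ·) hq
  simp only [hG, Matrix.add_mulVec, Matrix.one_mulVec, ← Matrix.mulVec_mulVec, dotProduct_add,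
    hdot x] at hx
  simp only [hsdef, dotProduct_smul, sub_dotProduct, dotProduct_sub, dotProduct_add, smul_eq_mul,
    hdot q]
  rw [hdot p x, dotProduct_comm (A *ᵥ p) x, hdot x p]
  rw [dotProduct_comm (A *ᵥ q) (A *ᵥ x)]
  rw [dotProduct_comm q x]
  linarith

/-! ### The potential, its gradient and Laplacian, and the integral identity. -/

section Divergence

variable {u : (Fin n → ℝ) → ℝ}

/-- Eight times the coordinate differential of the potential. -/
noncomputable def covector (u : (Fin n → ℝ) → ℝ) (x : Fin n → ℝ) : Fin n → ℝ :=
  x + hess u x *ᵥ grad u x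

/-- The tangential part of the position vector of the Lagrangian graph, in the coordinates `x`. -/
noncomputable def tangentialPart (u : (Fin n → ℝ) → ℝ) (x : Fin n → ℝ) : Fin n → ℝ :=
  (gram u x)⁻¹ *ᵥ covector u x

/-- The volume density of the graph. -/
noncomputable def density (u : (Fin n → ℝ) → ℝ) (x : Fin n → ℝ) : ℝ :=
  Real.sqrt (inducedMetric u x).det

/-- The squared norm of the gradient of the potential. -/
noncomputable def gradSq (u : (Fin n → ℝ) → ℝ) (x : Fin n → ℝ) : ℝ :=
  (1 / 16) * (tangentialPart u x ⬝ᵥ covector u x)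

theorem gram_mulVec_tangentialPart (hu : ContDiff ℝ ∞ u) (x : Fin n → ℝ) :
    gram u x *ᵥ tangentialPart u x = covector u x := by
  rw [tangentialPart, Matrix.mulVec_mulVec,
    Matrix.mul_nonsing_inv _ (gram_posDef hu x).det_pos.ne'.isUnit, Matrix.one_mulVec]

theorem gradSq_nonneg (hu : ContDiff ℝ ∞ u) (x : Fin n → ℝ) : 0 ≤ gradSq u x := by
  rw [gradSq, ← gram_mulVec_tangentialPart hu]
  have := (gram_posDef hu x).posSemidef.dotProduct_mulVec_nonneg (tangentialPart u x)
  simp only [star_trivial] at this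
  positivity

/-- Projection does not increase length: up to the factor `16`, the difference is `|(x, Du) - (q,
D²u q)|²`, where `(q, D²u q)` is the orthogonal projection of `(x, Du)` to the tangent space. -/
theorem gradSq_le_potential (hu : ContDiff ℝ ∞ u) (x : Fin n → ℝ) :
    gradSq u x ≤ potential u x := by
  set q := tangentialPart u x with hq
  set A := hess u x with hA
  set p := grad u x with hp
  have hdot : ∀ v w : Fin n → ℝ, v ⬝ᵥ (A *ᵥ w) = (A *ᵥ v) ⬝ᵥ w := fun v w => by
    rw [Matrix.dotProduct_mulVec, ← Matrix.mulVec_transpose, hA, hess_transpose hu]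
  have h1 : q ⬝ᵥ covector u x = q ⬝ᵥ q + (A *ᵥ q) ⬝ᵥ (A *ᵥ q) := by
    rw [← gram_mulVec_tangentialPart hu, gram, Matrix.add_mulVec, Matrix.one_mulVec,
      ← Matrix.mulVec_mulVec, dotProduct_add, hdot]
  have h2 : q ⬝ᵥ covector u x = q ⬝ᵥ x + (A *ᵥ q) ⬝ᵥ p := by
    rw [covector, dotProduct_add, hdot]
  have h3 : 0 ≤ (x - q) ⬝ᵥ (x - q) + (p - A *ᵥ q) ⬝ᵥ (p - A *ᵥ q) := by
    simp only [dotProduct]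
    exact add_nonneg (Finset.sum_nonneg fun i _ => mul_self_nonneg _)
      (Finset.sum_nonneg fun i _ => mul_self_nonneg _)
  simp only [sub_dotProduct, dotProduct_sub, dotProduct_comm x q, dotProduct_comm p (A *ᵥ q)] at h3
  rw [gradSq, potential_eq]
  linarith

theorem contDiff_grad (hu : ContDiff ℝ ∞ u) (i : Fin n) : ContDiff ℝ ∞ fun x => grad u x i :=
  contDiff_pd hu i

theorem contDiff_gram (hu : ContDiff ℝ ∞ u) (i j : Fin n) :
    ContDiff ℝ ∞ fun x => gram u x i j := by
  simp only [gram, Matrix.add_apply, Matrix.mul_apply]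
  exact contDiff_const.add
    (ContDiff.sum fun k _ => (contDiff_hess hu i k).mul (contDiff_hess hu k j))

theorem contDiff_covector (hu : ContDiff ℝ ∞ u) (i : Fin n) :
    ContDiff ℝ ∞ fun x => covector u x i := by
  simp only [covector, Pi.add_apply, Matrix.mulVec, dotProduct]
  exact (contDiff_apply ℝ ℝ i).add
    (ContDiff.sum fun k _ => (contDiff_hess hu i k).mul (contDiff_grad hu k))

theorem contDiff_tangentialPart (hu : ContDiff ℝ ∞ u) (i : Fin n) :
    ContDiff ℝ ∞ fun x => tangentialPart u x i := by
  simp only [tangentialPart, Matrix.mulVec, dotProduct]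
  exact ContDiff.sum fun k _ => (contDiff_inv (contDiff_gram hu)
    (fun x => (gram_posDef hu x).det_pos.ne') i k).mul (contDiff_covector hu k)

theorem contDiff_gradSq (hu : ContDiff ℝ ∞ u) : ContDiff ℝ ∞ (gradSq u) := by
  have h1 := contDiff_covector hu
  have h2 := contDiff_tangentialPart hu
  unfold gradSq dotProduct
  fun_prop

theorem contDiff_potential (hu : ContDiff ℝ ∞ u) : ContDiff ℝ ∞ (potential u) := by
  have h1 := contDiff_grad hu
  rw [show potential u = fun x => _ from funext fun x => potential_eq x]
  unfold dotProduct
  fun_prop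

theorem density_eq (hu : ContDiff ℝ ∞ u) (x : Fin n → ℝ) :
    density u x = Real.sqrt ((1 / 4 : ℝ) ^ n * (gram u x).det) := by
  rw [density, inducedMetric_eq hu, Matrix.det_smul, Fintype.card_fin]

theorem density_pos (hu : ContDiff ℝ ∞ u) (x : Fin n → ℝ) : 0 < density u x := by
  rw [density_eq hu]
  exact Real.sqrt_pos.2 (mul_pos (by positivity) (gram_posDef hu x).det_pos)

theorem contDiff_density (hu : ContDiff ℝ ∞ u) : ContDiff ℝ ∞ (density u) := by
  rw [funext (density_eq hu)]
  exact (contDiff_const.mul (contDiff_det (contDiff_gram hu))).sqrt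
    fun x => (mul_pos (by positivity) (gram_posDef hu x).det_pos).ne'

theorem pd_hess (k i j : Fin n) (x : Fin n → ℝ) :
    pd k (fun y => hess u y i j) x = third u k x i j := rfl

theorem pd_gram (hu : ContDiff ℝ ∞ u) (k i j : Fin n) (x : Fin n → ℝ) :
    pd k (fun y => gram u y i j) x =
      (third u k x * hess u x + hess u x * third u k x) i j := by
  have d : ∀ i j, Differentiable ℝ fun x => hess u x i j := fun i j =>
    (contDiff_hess hu i j).differentiable (by simp)
  simp only [gram, Matrix.add_apply, Matrix.mul_apply]
  rw [pd_add (by fun_prop) (by fun_prop), pd_const, zero_add,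
    pd_sum fun a _ => by fun_prop, ← Finset.sum_add_distrib]
  refine Finset.sum_congr rfl fun a _ => ?_
  rw [pd_mul (d _ _ x) (d _ _ x), pd_hess, pd_hess, add_comm]

theorem pd_density (hu : ContDiff ℝ ∞ u) (k : Fin n) (x : Fin n → ℝ) :
    pd k (density u) x = density u x * ((1 / 2) * ((gram u x)⁻¹ *
      (third u k x * hess u x + hess u x * third u k x)).trace) := by
  have hp := (gram_posDef hu x).det_pos
  have hc : (0 : ℝ) < (1 / 4 : ℝ) ^ n := by positivity
  have d : Differentiable ℝ fun y => (gram u y).det :=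
    (contDiff_det (contDiff_gram hu)).differentiable (by simp)
  have hdet : pd k (fun y => (gram u y).det) x = (gram u x).det * ((gram u x)⁻¹ *
      (third u k x * hess u x + hess u x * third u k x)).trace := by
    rw [pd_det fun i j => (contDiff_gram hu i j).differentiable (by simp) x, Matrix.inv_def,
      Ring.inverse_eq_inv', Matrix.smul_mul, Matrix.trace_smul, smul_eq_mul,
      mul_inv_cancel_left₀ hp.ne']
    congr 2
    ext i j
    exact pd_gram hu k i j x
  have h1 : pd k (density u) x = 1 / (2 * density u x) *
      ((1 / 4 : ℝ) ^ n * pd k (fun y => (gram u y).det) x) := by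
    rw [density_eq hu x, funext (density_eq hu)]
    unfold pd
    rw [((d x).hasFDerivAt.const_mul ((1 / 4 : ℝ) ^ n)).sqrt (mul_pos hc hp).ne' |>.fderiv]
    simp
  have h2 : (1 / 4 : ℝ) ^ n * (gram u x).det = density u x * density u x := by
    rw [density_eq hu, Real.mul_self_sqrt (mul_pos hc hp).le]
  have h3 := (density_pos hu x).ne'
  rw [h1, hdet, ← mul_assoc ((1 / 4 : ℝ) ^ n), h2]
  field_simp

theorem pd_covector (hu : ContDiff ℝ ∞ u) (k i : Fin n) (x : Fin n → ℝ) :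
    pd k (fun y => covector u y i) x =
      (gram u x *ᵥ Pi.single k 1 + third u k x *ᵥ grad u x) i := by
  have d : ∀ i j, Differentiable ℝ fun x => hess u x i j := fun i j =>
    (contDiff_hess hu i j).differentiable (by simp)
  have d' : ∀ i, Differentiable ℝ fun x => grad u x i := fun i =>
    (contDiff_grad hu i).differentiable (by simp)
  simp only [covector, Pi.add_apply, Matrix.mulVec, dotProduct]
  rw [pd_add (by fun_prop) (by fun_prop), pd_coord, pd_sum fun a _ => by fun_prop]
  have h : ∀ a, pd k (fun y => hess u y i a * grad u y a) x =
      hess u x i a * hess u x a k + third u k x i a * grad u x a := fun a => by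
    rw [pd_mul (d _ _ x) (d' _ x), pd_hess, hess_symm hu x a k]; rfl
  simp only [h, Finset.sum_add_distrib]
  simp [gram, Matrix.mul_apply, Matrix.one_apply, Pi.single_apply, eq_comm]
  ring

theorem pd_potential (hu : ContDiff ℝ ∞ u) (k : Fin n) (x : Fin n → ℝ) :
    pd k (potential u) x = (1 / 8) * covector u x k := by
  have d' : ∀ i, Differentiable ℝ fun x => grad u x i := fun i =>
    (contDiff_grad hu i).differentiable (by simp)
  rw [show potential u = fun x => _ from funext fun x => potential_eq x]
  simp only [dotProduct]
  rw [pd_mul (by fun_prop) (by fun_prop), pd_const, pd_add (by fun_prop) (by fun_prop),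
    pd_sum fun a _ => by fun_prop, pd_sum fun a _ => by fun_prop]
  have h1 : ∀ a, pd k (fun y => y a * y a) x =
      2 * ((1 : Matrix (Fin n) (Fin n) ℝ) k a * x a) := fun a => by
    rw [pd_mul (by fun_prop) (by fun_prop), pd_coord]; ring
  have h2 : ∀ a, pd k (fun y => grad u y a * grad u y a) x =
      2 * (hess u x k a * grad u x a) := fun a => by
    rw [pd_mul (d' _ x) (d' _ x), show pd k (fun y => grad u y a) x = hess u x k a from rfl]; ring
  simp only [h1, h2, ← Finset.mul_sum]
  simp [Matrix.one_apply, covector, Matrix.mulVec, dotProduct]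
  ring

/-- The identity `Δf = n/2 - f + |∇f|²` on a self-shrinker, in divergence form. -/
theorem IsSelfShrinker.divergence {θ : (Fin n → ℝ) → ℝ} (h : IsSelfShrinker u θ)
    (hu : ContDiff ℝ ∞ u) (x : Fin n → ℝ) :
    ∑ k, pd k (fun y => density u y * tangentialPart u y k) x =
      density u x * (2 * (n / 2 - potential u x + gradSq u x)) := by
  have dq : ∀ i, Differentiable ℝ fun x => tangentialPart u x i := fun i =>
    (contDiff_tangentialPart hu i).differentiable (by simp)
  have dG : ∀ i j, Differentiable ℝ fun x => gram u x i j := fun i j =>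
    (contDiff_gram hu i j).differentiable (by simp)
  have dρ : Differentiable ℝ (density u) := (contDiff_density hu).differentiable (by simp)
  have hQ : ∀ k, (third u k x * hess u x + hess u x * third u k x) *ᵥ tangentialPart u x +
      gram u x *ᵥ (fun i => pd k (fun y => tangentialPart u y i) x) =
      gram u x *ᵥ Pi.single k 1 + third u k x *ᵥ grad u x := by
    intro k
    ext i
    rw [← pd_covector hu]
    simp_rw [← gram_mulVec_tangentialPart hu]
    simp only [Matrix.mulVec, dotProduct, Pi.add_apply]
    rw [pd_sum fun a _ => by fun_prop, ← Finset.sum_add_distrib]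
    refine Finset.sum_congr rfl fun a _ => ?_
    rw [pd_mul (dG _ _ x) (dq _ x), pd_gram hu, add_comm]
  have key := trace_add_half_trace_eq (G := gram u x) (hess_transpose hu x) rfl
    (gram_posDef hu x).det_pos.ne'.isUnit (fun k => third_transpose hu k x)
    (fun k i j => third_swap hu k i j x) (gram_mulVec_tangentialPart hu x) hQ
    (fun k => h.trace_third hu k x)
  have h1 : ∀ k, pd k (fun y => density u y * tangentialPart u y k) x =
      density u x * (pd k (fun y => tangentialPart u y k) x + (1 / 2) * ((gram u x)⁻¹ *
        (third u k x * hess u x + hess u x * third u k x)).trace * tangentialPart u x k) := by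
    intro k
    rw [pd_mul (dρ x) (dq k x), pd_density hu]
    ring
  simp only [h1, ← Finset.mul_sum, Finset.sum_add_distrib, key]
  rw [potential_eq, gradSq, covector]
  ring

/-- Properness is immediate from `f ≥ |x|²/16`. -/
theorem isCompact_potential_le (hu : ContDiff ℝ ∞ u) (R : ℝ) :
    IsCompact {x | potential u x ≤ R} := by
  refine (isCompact_Icc (a := fun _ : Fin n => -(16 * R + 1))
    (b := fun _ => 16 * R + 1)).of_isClosed_subset
    (isClosed_le (contDiff_potential hu).continuous continuous_const) fun x hx => ?_
  have hx : potential u x ≤ R := hx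
  rw [potential_eq] at hx
  have h1 : 0 ≤ grad u x ⬝ᵥ grad u x := Finset.sum_nonneg fun i _ => mul_self_nonneg _
  have h2 : ∀ i, x i * x i ≤ x ⬝ᵥ x := fun i =>
    Finset.single_le_sum (f := fun i => x i * x i) (fun i _ => mul_self_nonneg _)
      (Finset.mem_univ i)
  have h3 : ∀ i, |x i| ≤ 16 * R + 1 := fun i => by
    have := h2 i
    rw [← abs_mul_abs_self] at this
    nlinarith [sq_nonneg (|x i| - 1), abs_nonneg (x i)]
  exact ⟨fun i => (abs_le.1 (h3 i)).1, fun i => (abs_le.1 (h3 i)).2⟩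

theorem integral_pd_eq_zero {F : (Fin n → ℝ) → ℝ} (hF : ContDiff ℝ 1 F)
    (hs : HasCompactSupport F) (k : Fin n) : ∫ x, pd k F x = 0 := by
  have hi : Integrable fun x => fderiv ℝ F x (Pi.single k 1) :=
    ((hF.continuous_fderiv one_ne_zero).clm_apply continuous_const).integrable_of_hasCompactSupport
      (hs.fderiv_apply ℝ _)
  have := integral_mul_fderiv_eq_neg_fderiv_mul_of_integrable (μ := volume)
    (f := fun _ : Fin n → ℝ => (1 : ℝ)) (g := F) (v := Pi.single k 1) (by simp) (by simpa using hi)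
    (by simpa using hF.continuous.integrable_of_hasCompactSupport hs)
    (fun _ _ => differentiableAt_const _) (fun x _ => hF.differentiable one_ne_zero x)
  simpa [pd] using this

/-- The divergence theorem for `Φ(f) ρ q`, with `ρ` the volume density; its support is compact
because `f` is proper and `Φ` vanishes past `S`. -/
theorem IsSelfShrinker.integral_eq_zero {θ : (Fin n → ℝ) → ℝ} (h : IsSelfShrinker u θ)
    (hu : ContDiff ℝ ∞ u) {Φ : ℝ → ℝ} (hΦ : ContDiff ℝ 1 Φ) (h0 : ∃ S, ∀ s, S ≤ s → Φ s = 0) :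
    ∫ x, Φ (potential u x) * (n / 2 - potential u x) +
      (deriv Φ (potential u x) + Φ (potential u x)) * gradSq u x ∂(volumeMeasure u) = 0 := by
  obtain ⟨S, hS⟩ := h0
  have cf : ContDiff ℝ 1 (potential u) := (contDiff_potential hu).of_le (mod_cast le_top)
  have cY : ∀ k, ContDiff ℝ 1 fun y => density u y * tangentialPart u y k := fun k =>
    ((contDiff_density hu).mul (contDiff_tangentialPart hu k)).of_le (mod_cast le_top)
  have cF : ∀ k, ContDiff ℝ 1 fun y =>
      Φ (potential u y) * (density u y * tangentialPart u y k) := fun k =>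
    (hΦ.comp cf).mul (cY k)
  have sF : ∀ k, HasCompactSupport fun y =>
      Φ (potential u y) * (density u y * tangentialPart u y k) := fun k =>
    HasCompactSupport.intro (isCompact_potential_le hu S) fun x hx => by
      rw [hS _ (le_of_lt (not_le.1 hx)), zero_mul]
  have hpd : ∀ k x, pd k (fun y => Φ (potential u y)) x =
      deriv Φ (potential u x) * ((1 / 8) * covector u x k) := fun k x => by
    have hc : fderiv ℝ (fun y => Φ (potential u y)) x =
        deriv Φ (potential u x) • fderiv ℝ (potential u) x :=
      ((hΦ.differentiable one_ne_zero _).hasDerivAt.comp_hasFDerivAt x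
        (cf.differentiable one_ne_zero x).hasFDerivAt).fderiv
    rw [← pd_potential hu]
    unfold pd
    rw [hc]
    rfl
  have hdiv : ∀ x, ∑ k, pd k (fun y => Φ (potential u y) *
      (density u y * tangentialPart u y k)) x = 2 * (density u x *
        (Φ (potential u x) * (n / 2 - potential u x) +
          (deriv Φ (potential u x) + Φ (potential u x)) * gradSq u x)) := by
    intro x
    have h1 : ∀ k, pd k (fun y => Φ (potential u y) *
        (density u y * tangentialPart u y k)) x =
        Φ (potential u x) * pd k (fun y => density u y * tangentialPart u y k) x +
        deriv Φ (potential u x) * (1 / 8) * density u x *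
          (tangentialPart u x k * covector u x k) := fun k => by
      rw [pd_mul (F := fun y => Φ (potential u y)) ((hΦ.comp cf).differentiable one_ne_zero x)
        ((cY k).differentiable one_ne_zero x), hpd]
      ring
    have h2 : ∑ k, tangentialPart u x k * covector u x k = 16 * gradSq u x := by
      rw [gradSq, dotProduct]; ring
    simp only [h1, Finset.sum_add_distrib, ← Finset.mul_sum, h.divergence hu, h2]
    ring
  have hint : ∀ k, Integrable fun x => pd k (fun y => Φ (potential u y) *
      (density u y * tangentialPart u y k)) x := fun k =>
    (((cF k).continuous_fderiv one_ne_zero).clm_apply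
      continuous_const).integrable_of_hasCompactSupport ((sF k).fderiv_apply ℝ _)
  have hz : ∫ x, ∑ k, pd k (fun y => Φ (potential u y) *
      (density u y * tangentialPart u y k)) x = 0 := by
    rw [integral_finsetSum _ fun k _ => hint k]
    exact Finset.sum_eq_zero fun k _ => integral_pd_eq_zero (cF k) (sF k) k
  simp only [hdiv] at hz
  rw [integral_const_mul] at hz
  have hm : Measurable fun x => ENNReal.ofReal (density u x) :=
    (contDiff_density hu).continuous.measurable.ennreal_ofReal
  change ∫ x, _ ∂(volume.withDensity fun x => ENNReal.ofReal (density u x)) = 0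
  rw [integral_withDensity_eq_integral_toReal_smul hm
    (Filter.Eventually.of_forall fun x => ENNReal.ofReal_lt_top)]
  simp only [ENNReal.toReal_ofReal (density_pos hu _).le, smul_eq_mul]
  linarith

end Divergence

end ContactGraph

open ContactGraph in
theorem lemma3 :
    ∃ C : ℝ → ℝ, (∀ w, 0 < C w) ∧
      ∀ (n : ℕ) (u θ : (Fin n → ℝ) → ℝ), ContDiff ℝ ∞ u → ContactGraph.IsSelfShrinker u θ →
        MeasureTheory.Integrable (fun x => Real.exp (-ContactGraph.potential u x))
          (ContactGraph.volumeMeasure u) ∧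
        ∀ r : ℝ, 1 ≤ r →
          ContactGraph.volumeMeasure u (ContactGraph.sublevel u r) ≤
            ENNReal.ofReal (C (ContactGraph.weightedVolume u) * r ^ n) := by
  -- The absolute value and the `+ 1` only serve to make the constant positive for every real `w`.
  refine ⟨fun w => Real.exp (1 / 4) * |w| + 1, fun w => by positivity, fun n u θ hu h => ?_⟩
  have : IsLocallyFiniteMeasure (volumeMeasure u) :=
    IsLocallyFiniteMeasure.withDensity_ofReal (contDiff_density hu).continuous
  obtain ⟨hI, hV⟩ := integrable_exp_neg_and_measure_le (μ := volumeMeasure u) (k := n / 2)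
    (contDiff_potential hu).continuous (contDiff_gradSq hu).continuous (gradSq_nonneg hu)
    (gradSq_le_potential hu) (isCompact_potential_le hu) fun Φ hΦ h0 => h.integral_eq_zero hu hΦ h0
  refine ⟨hI, fun r hr => ?_⟩
  have hr0 : 0 < r := by linarith
  -- The parameter is `l = r⁻²`, which lies in `(0,1]` because `r ≥ 1`; then `l ^ (-n/2) = r ^ n`.
  have hset : sublevel u r = {x | potential u x ≤ 1 / (4 * (r ^ 2)⁻¹)} := by
    ext x
    change 2 * Real.sqrt (potential u x) ≤ r ↔ potential u x ≤ 1 / (4 * (r ^ 2)⁻¹)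
    rw [show 1 / (4 * (r ^ 2)⁻¹) = (r / 2) ^ 2 by field_simp; norm_num,
      ← Real.sqrt_le_left (by positivity), le_div_iff₀ two_pos, mul_comm]
  rw [hset]
  refine (hV _ (by positivity) (inv_le_one_of_one_le₀ (one_le_pow₀ hr))).trans
    (ENNReal.ofReal_le_ofReal ?_)
  have hp : ((r ^ 2)⁻¹ : ℝ) ^ (-((n : ℝ) / 2)) = r ^ n := by
    rw [Real.inv_rpow (by positivity), Real.rpow_neg (by positivity), inv_inv,
      ← Real.rpow_natCast r 2, ← Real.rpow_mul hr0.le, ← Real.rpow_natCast r n]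
    congr 1
    push_cast; ring
  rw [hp]
  refine mul_le_mul_of_nonneg_right ?_ (by positivity)
  have := mul_le_mul_of_nonneg_left (le_abs_self (weightedVolume u)) (Real.exp_pos (1 / 4)).le
  change Real.exp (1 / 4) * weightedVolume u ≤ _
  linarith
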